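/- **Conventions.** Fix a universe $\mathfrak U$; sets and sets of morphisms are $\mathfrak U$-small, and presheaves and sheaves are sheaves of ($\mathfrak U$-small) sets. For a Grothendieck topology $J$ on a category $\mathcal C$, let $\mathcal T(J)$ be the collection of morphisms $f:Y\to X$ such that the sieve on $X$ generated by $f$ is $J$-covering, and let $\mathcal C(\mathcal T(J))$ be the subcategory of $\mathcal C$ with the same objects and with the morphisms in $\mathcal T(J)$. A collection $\mathcal T$ of morphisms is *semi-localizing* if it contains the identities, is closed under composition, and for every $f_1:Y_1\to X$ in $\mathcal T$ and every $f_2:Y_2\to X$ there are $g_1:Z\to Y_1$ and $g_2:Z\to Y_2$ with $g_2\in\mathcal T$ and $f_1g_1=f_2g_2$. $J$ is an *$A$-topology* if for some semi-localizing $\mathcal T$ the covering sieves are exactly the sieves containing a morphism of $\mathcal T$. A map $\phi:S\to S'$ from a set with a left action of a group $G$ is a *pseudo $G$-torsor* if $\phi$ is $G$-invariant, $G$ acts freely on $S$, and the induced map $G\backslash S\to S'$ is injective. A morphism $f:Y\to X$ is a *Galois covering* if there are a group $G$ and a homomorphism $\rho:G\to\mathrm{Aut}_X(Y)$ such that for every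 $Z$ the map $\mathrm{Hom}(Z,Y)\to\mathrm{Hom}(Z,X)$, $h\mapsto fh$, is a pseudo $G$-torsor, where $g\in G$ acts by $h\mapsto\rho(g)h$. For a collection $\mathcal T$ put $\widehat{\mathcal T}=\{f : fg\in\mathcal T\text{ for some }g\}$; $\mathcal T$ *has enough Galois coverings* if $\widehat{\mathcal T'}=\widehat{\mathcal T}$, where $\mathcal T'$ is the collection of Galois coverings that belong to $\mathcal T$. A category is *$\Lambda$-connected* if any two of its objects receive morphisms from a common object. A *$Y$-site* $(\mathcal C,J)$ is an essentially $\mathfrak U$-small category $\mathcal C$ in which every morphism is an epimorphism, with an $A$-topology $J$ such that $gf\in\mathcal T(J)$ if and only if $f,g\in\mathcal T(J)$ (for all composable $f,g$), $\mathcal C(\mathcal T(J))$ is $\Lambda$-connected, and $\mathcal T(J)$ has enough Galois coverings. A *grid* of $(\mathcal C,J)$ is a $\mathfrak U$-small $\Lambda$-connected poset $\mathcal C_0$ (regarded as a category, with one morphism $x\to y$ if $x\le y$) with a functor $\iota_0:\mathcal C_0\to\mathcal C$ such that: (a) every object of $\mathcal C$ is isomorphic to $\iota_0(X)$ for some *edge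 object* $X$, i.e. an object $X$ of $\mathcal C_0$ such that $\iota_0(f)\in\mathcal T(J)$ for every morphism $f$ with target $X$; (b) for every object $X$ of $\mathcal C_0$ and every $f:Y\to\iota_0(X)$ in $\mathcal T(J)$ there are $f':Y'\to X$ in $\mathcal C_0$ and an isomorphism $\alpha:Y\cong\iota_0(Y')$ with $f=\iota_0(f')\alpha$; (c) for every object $X$ of $\mathcal C_0$ the functor of undercategories $\mathcal C_{0,X/}\to\mathcal C_{\iota_0(X)/}$ induced by $\iota_0$ is an equivalence. The *fiber functor* of a grid sends a presheaf $F$ on $\mathcal C$ to $\omega(F)=\varinjlim_X F(\iota_0(X))$, where $X$ runs over the edge objects. A *point* of a topos $E$ is a pair $(F_*,F^*)$ of functors $F_*:\mathrm{Sets}\to E$ and $F^*:E\to\mathrm{Sets}$ such that $F^*$ is left adjoint to $F_*$ and preserves finite limits. $E$ *has enough points* if there is a ($\mathfrak U$-small) family of points whose functors $F^*$ jointly reflect isomorphisms. **Theorem.** Let $(\mathcal C,J)$ be a $Y$-site. Assume that, for every object $X$ of $\mathcal C$, the category $\mathcal D=\mathcal C(\mathcal T(J))_{/X}$ satisfies at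 least one of the following conditions: (1) all sets $\mathrm{Hom}_{\mathcal D}(A,B)$ are finite; (2) there is an at most countable set $S$ of objects of $\mathcal D$ such that every object of $\mathcal D$ receives a morphism from an object in $S$. (i) Suppose that $\mathcal C$ is non-empty and let $(\mathcal C_0,\iota_0)$ be a grid of $(\mathcal C,J)$, with fiber functor $\omega$. Let $F^*$ be the restriction of $\omega$ to $\mathrm{Shv}(\mathcal C,J)$, and for a set $Y$ let $F_*(Y)$ be the presheaf $X\mapsto\mathrm{Map}(\omega(\mathrm{Hom}_{\mathcal C}(-,X)),Y)$. Then $F^*$ preserves finite limits, $F_*(Y)$ is a sheaf for every set $Y$, the functor $F_*:\mathrm{Sets}\to\mathrm{Shv}(\mathcal C,J)$ is right adjoint to $F^*$, and $(F_*,F^*)$ is a point of the topos $\mathrm{Shv}(\mathcal C,J)$. (ii) The topos $\mathrm{Shv}(\mathcal C,J)$ has enough points. -/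

import Mathlib

open CategoryTheory Limits Opposite

universe w u

/-! ### Semi-localizing collections and `A`-topologies -/

/-- A collection `T` of morphisms is semi-localizing if it contains the identities, is closed
under composition and satisfies the right Ore condition. -/
structure IsSemiLocalizing {C : Type u} [Category.{w} C] (T : MorphismProperty C) : Prop where
  id_mem : ∀ X : C, T (𝟙 X)
  comp_mem : ∀ {X Y Z : C} (f : X ⟶ Y) (g : Y ⟶ Z), T f → T g → T (f ≫ g)
  ore : ∀ {X Y₁ Y₂ : C} (f₁ : Y₁ ⟶ X) (f₂ : Y₂ ⟶ X), T f₁ →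
    ∃ (Z : C) (g₁ : Z ⟶ Y₁) (g₂ : Z ⟶ Y₂), T g₂ ∧ g₁ ≫ f₁ = g₂ ≫ f₂

/-- `J` is an `A`-topology if there is a semi-localizing collection `T` such that the covering
sieves of `J` are exactly the sieves which contain a morphism that belongs to `T`. -/
def IsATopology {C : Type u} [Category.{w} C] (J : GrothendieckTopology C) : Prop :=
  ∃ T : MorphismProperty C, IsSemiLocalizing T ∧
    ∀ (X : C) (R : Sieve X), R ∈ J X ↔ ∃ (Y : C) (f : Y ⟶ X), R f ∧ T f

/-- The collection `𝒯(J)` of the morphisms `f : Y ⟶ X` such that the sieve on `X` generated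
by `f` is a covering sieve. -/
def coveringMorphisms {C : Type u} [Category.{w} C] (J : GrothendieckTopology C) :
    MorphismProperty C :=
  fun _ X f => Sieve.generate (Presieve.singleton f) ∈ J X

instance coveringMorphisms_isMultiplicative {C : Type u} [Category.{w} C]
    (J : GrothendieckTopology C) : (coveringMorphisms J).IsMultiplicative where
  id_mem X := by
    refine J.superset_covering ?_ (J.top_mem X)
    intro Y f _
    exact ⟨X, f, 𝟙 X, Presieve.singleton_self _, by simp⟩
  comp_mem {X Y Z} f g hf hg := by
    refine J.transitive hg _ ?_
    rintro W h ⟨Y', a, b, hb, rfl⟩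
    cases hb
    refine J.superset_covering ?_ (J.pullback_stable a hf)
    rintro V c ⟨X', d, e, he, hde⟩
    cases he
    exact ⟨X, d, f ≫ g, Presieve.singleton_self _, by
      simp only [← Category.assoc, hde]⟩

/-- The category `𝒞(𝒯(J))`: same objects as `C`, and those morphisms which belong
to `𝒯(J)`. -/
abbrev CoveringCategory {C : Type u} [Category.{w} C] (J : GrothendieckTopology C) : Type u :=
  WideSubcategory (coveringMorphisms J)

/-! ### Galois coverings -/

/-- A map `φ : S → S'` from a `G`-set `S` is a pseudo `G`-torsor if it is `G`-invariant, `G`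
acts freely on `S`, and the induced map `G \ S → S'` is injective. -/
structure IsPseudoTorsor (G : Type*) [Group G] {S S' : Type*} [MulAction G S]
    (φ : S → S') : Prop where
  invariant : ∀ (g : G) (s : S), φ (g • s) = φ s
  free : ∀ (g : G) (s : S), g • s = s → g = 1
  injective : ∀ s t : S, φ s = φ t → ∃ g : G, g • s = t

/-- The action on `Hom(Z, Y)` by composition, of a group `G` that is sent by `ρ` to the group
`Aut_X(Y)` of automorphisms of `Y` over `X`. -/
abbrev homMulAction {C : Type u} [Category.{w} C] {X Y : C} {f : Y ⟶ X} {G : Type*} [Group G]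
    (ρ : G →* Aut (Over.mk f)) (Z : C) : MulAction G (Z ⟶ Y) where
  smul g h := h ≫ (ρ g).hom.left
  one_smul h := by
    change h ≫ (ρ 1).hom.left = h
    rw [map_one]
    exact Category.comp_id h
  mul_smul g g' h := by
    change h ≫ (ρ (g * g')).hom.left = (h ≫ (ρ g').hom.left) ≫ (ρ g).hom.left
    rw [map_mul, Category.assoc]
    rfl

/-- A morphism `f : Y ⟶ X` is a Galois covering if there are a group `G` and a homomorphism
`G → Aut_X(Y)` such that, for every `Z`, composition with `f` makes `Hom(Z, Y) → Hom(Z, X)`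
a pseudo `G`-torsor. -/
def IsGaloisCovering {C : Type u} [Category.{w} C] {X Y : C} (f : Y ⟶ X) : Prop :=
  ∃ (G : Type w) (_ : Group G) (ρ : G →* Aut (Over.mk f)), ∀ Z : C,
    @IsPseudoTorsor G _ (Z ⟶ Y) (Z ⟶ X) (homMulAction ρ Z) (fun h => h ≫ f)

/-- For a collection `T`, the collection of the morphisms `f` such that `g ≫ f ∈ T` for
some `g`. -/
def dominated {C : Type u} [Category.{w} C] (T : MorphismProperty C) : MorphismProperty C :=
  fun Y _ f => ∃ (Z : C) (g : Z ⟶ Y), T (g ≫ f)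

/-- `T` has enough Galois coverings: `T` and the collection of the Galois coverings in `T`
dominate the same morphisms. -/
def HasEnoughGaloisCoverings {C : Type u} [Category.{w} C] (T : MorphismProperty C) : Prop :=
  dominated (fun _ _ f => T f ∧ IsGaloisCovering f) = dominated T

/-! ### `Y`-sites and the cardinality conditions -/

/-- A category is `Λ`-connected if any two objects receive morphisms from a common object. -/
def IsLambdaConnected (D : Type*) [Category* D] : Prop :=
  ∀ X Y : D, ∃ Z : D, Nonempty (Z ⟶ X) ∧ Nonempty (Z ⟶ Y)

/-- `B`-sites. -/
structure IsBSite {C : Type u} [Category.{w} C] (J : GrothendieckTopology C) : Prop where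
  epi : ∀ {X Y : C} (f : X ⟶ Y), Epi f
  isATopology : IsATopology J
  comp_mem_iff : ∀ {X Y Z : C} (g : Z ⟶ Y) (f : Y ⟶ X),
    coveringMorphisms J (g ≫ f) ↔ coveringMorphisms J f ∧ coveringMorphisms J g

/-- `Y`-sites. Smallness is relative to the universe `w`; the category `C` has `w`-small sets of
morphisms. -/
structure IsYSite {C : Type u} [Category.{w} C] (J : GrothendieckTopology C) : Prop
    extends IsBSite J where
  essentiallySmall : EssentiallySmall.{w} C
  isLambdaConnected : IsLambdaConnected (CoveringCategory J)
  enoughGalois : HasEnoughGaloisCoverings (coveringMorphisms J)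

/-- First cardinality condition: all sets of morphisms are finite. -/
def HasFiniteHoms (D : Type*) [Category* D] : Prop :=
  ∀ X Y : D, Finite (X ⟶ Y)

/-- Second cardinality condition: there is an at most countable set of objects such that every
object receives a morphism from one of them. -/
def HasCountableCoinitialSet (D : Type*) [Category* D] : Prop :=
  ∃ S : Set D, S.Countable ∧ ∀ X : D, ∃ Y ∈ S, Nonempty (Y ⟶ X)

/-! ### Grids and their fiber functors -/

/-- The edge objects of `C₀`: the objects `X` such that `ι₀` sends every morphism to `X` into
`𝒯(J)`. -/
def edgeObjects {C : Type u} [Category.{w} C] (J : GrothendieckTopology C)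
    {C₀ : Type w} [PartialOrder C₀] (ι₀ : C₀ ⥤ C) : ObjectProperty C₀ :=
  fun X => ∀ (Y : C₀) (f : Y ⟶ X), coveringMorphisms J (ι₀.map f)

/-- Grids of a site: here `C₀` is a (`w`-small) poset regarded as a category, with a unique
morphism from `x` to `y` if `x ≤ y` and none otherwise. -/
structure IsGrid {C : Type u} [Category.{w} C] (J : GrothendieckTopology C)
    {C₀ : Type w} [PartialOrder C₀] (ι₀ : C₀ ⥤ C) : Prop where
  isLambdaConnected : IsLambdaConnected C₀
  exists_edge : ∀ X' : C, ∃ X : C₀, edgeObjects J ι₀ X ∧ Nonempty (ι₀.obj X ≅ X')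
  exists_lift : ∀ (X : C₀) (Y : C) (f : Y ⟶ ι₀.obj X), coveringMorphisms J f →
    ∃ (Y' : C₀) (f' : Y' ⟶ X) (α : Y ≅ ι₀.obj Y'), f = α.hom ≫ ι₀.map f'
  under_isEquivalence : ∀ X : C₀, (Under.post (X := X) ι₀).IsEquivalence

/-- The fiber functor `ω` on presheaves: `ω(F)` is the colimit of the sets `F(ι₀(X))`, where `X`
runs over the edge objects. -/
noncomputable def fiberFunctor {C : Type u} [Category.{w} C] (J : GrothendieckTopology C)
    {C₀ : Type w} [PartialOrder C₀] (ι₀ : C₀ ⥤ C) : (Cᵒᵖ ⥤ Type w) ⥤ Type w :=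
  (Functor.whiskeringLeft _ _ (Type w)).obj ((edgeObjects J ι₀).ι ⋙ ι₀).op ⋙ colim

/-- The restriction `F^*` of the fiber functor to sheaves. -/
noncomputable def sheafFiberFunctor {C : Type u} [Category.{w} C] (J : GrothendieckTopology C)
    {C₀ : Type w} [PartialOrder C₀] (ι₀ : C₀ ⥤ C) : Sheaf J (Type w) ⥤ Type w :=
  sheafToPresheaf J (Type w) ⋙ fiberFunctor J ι₀

/-- The functor `F_*` with values in presheaves: `F_*(Y)(X)` is the set of maps from
`ω(Hom(-, X))` to `Y`. -/
noncomputable def directImagePresheaf {C : Type u} [Category.{w} C] (J : GrothendieckTopology C)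
    {C₀ : Type w} [PartialOrder C₀] (ι₀ : C₀ ⥤ C) : Type w ⥤ (Cᵒᵖ ⥤ Type w) :=
  yoneda ⋙ (Functor.whiskeringLeft _ _ _).obj (yoneda ⋙ fiberFunctor J ι₀).op

/-- The functor `F_*` with values in sheaves, given that its values are sheaves. -/
noncomputable def directImageSheaf {C : Type u} [Category.{w} C] (J : GrothendieckTopology C)
    {C₀ : Type w} [PartialOrder C₀] (ι₀ : C₀ ⥤ C)
    (h : ∀ Y : Type w, Presheaf.IsSheaf J ((directImagePresheaf J ι₀).obj Y)) :
    Type w ⥤ Sheaf J (Type w) :=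
  ObjectProperty.lift _ (directImagePresheaf J ι₀) h

/-! ### Points of a topos -/

/-- A point of a topos `E`: a geometric morphism from the topos of sets to `E`, i.e. a functor
`E ⥤ Type w` which preserves finite limits, with a right adjoint. -/
structure ToposPoint (E : Type*) [Category* E] where
  inverseImage : E ⥤ Type w
  directImage : Type w ⥤ E
  adj : inverseImage ⊣ directImage
  preservesFiniteLimits : PreservesFiniteLimits inverseImage

/-- A topos has enough points if there is a (`w`-small) family of points whose inverse image
functors jointly reflect isomorphisms. -/
def ToposHasEnoughPoints (E : Type*) [Category* E] : Prop :=
  ∃ (I : Type w) (p : I → ToposPoint.{w} E),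
    JointlyReflectIsomorphisms fun i => (p i).inverseImage

/-!
A cofiltered diagram in `C` which dominates the covering morphisms, in the sense that each of them
becomes a right factor of a transition morphism, defines a point of the site. The edge objects
of a grid form such a diagram. This is (i), as `F_*` is the only possible right adjoint.

For (ii), consider the Galois coverings of a fixed object `X`, as objects of `𝒞(𝒯(J))/X`. The
endomorphisms of such an object act transitively on the morphisms to it, so two morphisms from
a Galois covering differ by an endomorphism of it, and any coinitial cofiltered diagram of Galois
coverings dominates the covering morphisms. The problem is to choose the transition morphisms
compatibly. A countable coinitial set gives a sequence, where compatibility is automatic. If the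
sets of morphisms are finite, compare the coverings `A i` and `A j` through arbitrary morphisms
`A k ⟶ A i` and `A k ⟶ A j`: there are only finitely many morphisms `A j ⟶ A i`, so one of them
is compatible with these for almost all `k` with respect to an ultrafilter. At the resulting
point the fiber of `X` has a canonical element. If it lifts along a morphism in a sieve on `X`,
then the sieve contains a covering morphism; hence the points attached to the objects `X` detect
the covering sieves, and they form a conservative family.
-/

section CofilteredDiagrams

/-- `p` dominates `W` if every morphism to some `p.obj U` which belongs to `W` is a right factor of
a transition morphism of the diagram `p`. -/
def DominatesMorphisms {C N : Type*} [Category* C] [Category* N] (p : N ⥤ C)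
    (W : MorphismProperty C) : Prop :=
  ∀ ⦃U : N⦄ ⦃Y : C⦄ (f : Y ⟶ p.obj U), W f → ∃ (V : N) (q : V ⟶ U) (a : p.obj V ⟶ Y),
    a ≫ f = p.map q

variable {C : Type u} [Category.{w} C] {J : GrothendieckTopology C}

lemma IsATopology.exists_coveringMorphisms_of_mem (hJ : IsATopology J) {X : C} {R : Sieve X}
    (hR : R ∈ J X) : ∃ (Y : C) (f : Y ⟶ X), R f ∧ coveringMorphisms J f := by
  obtain ⟨T, -, hT⟩ := hJ
  obtain ⟨Y, f, hRf, hTf⟩ := (hT X R).1 hR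
  exact ⟨Y, f, hRf, (hT X _).2 ⟨Y, f, Sieve.le_generate _ _ _ (Presieve.singleton_self f), hTf⟩⟩

variable {N : Type w} [SmallCategory N] [IsCofiltered N] {p : N ⥤ C}

instance initiallySmall_of_smallCategory (N : Type w) [SmallCategory N] : InitiallySmall.{w} N :=
  initiallySmall_of_essentiallySmall N

/-- The point of the site at which the fiber of `X` is the colimit of the sets `Hom(p.obj U, X)`. -/
noncomputable def DominatesMorphisms.point (hp : DominatesMorphisms p (coveringMorphisms J))
    (hJ : IsATopology J) : GrothendieckTopology.Point.{w} J :=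
  GrothendieckTopology.Point.ofIsCofiltered.{w} p fun X R hR U f => by
    obtain ⟨Y, g, hRg, hg⟩ := hJ.exists_coveringMorphisms_of_mem (J.pullback_stable f hR)
    obtain ⟨V, q, a, h⟩ := hp g hg
    exact ⟨Y, g ≫ f, hRg, V, q, a, by rw [← h, Category.assoc]⟩

/-- The fiber of presheaves at the point defined by a diagram is computed along the diagram. -/
noncomputable def DominatesMorphisms.presheafFiberIso
    (hp : DominatesMorphisms p (coveringMorphisms J)) (hJ : IsATopology J) :
    (Functor.whiskeringLeft _ _ (Type w)).obj p.op ⋙ colim ≅ (hp.point hJ).presheafFiber :=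
  let q : N ⥤ (hp.point hJ).fiber.Elements :=
    GrothendieckTopology.Point.ofIsCofiltered.functor.{w} p
  have : q.Initial :=
    inferInstanceAs (GrothendieckTopology.Point.ofIsCofiltered.functor.{w} p).Initial
  Functor.isoWhiskerLeft ((Functor.whiskeringLeft _ _ (Type w)).obj
    (CategoryOfElements.π (hp.point hJ).fiber).op) (Functor.Final.colimIso q.op)

end CofilteredDiagrams

section ToposPoints

variable {C : Type u} [Category.{w} C]

/-- A right adjoint `R` on presheaves is determined by its left adjoint `L`, since
`R(Y)(X) = Hom(Hom(-, X), R(Y)) = Hom(L(Hom(-, X)), Y)`. -/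
noncomputable def rightAdjointIso {E : Type*} [Category.{w} E] {L : (Cᵒᵖ ⥤ Type w) ⥤ E}
    {R : E ⥤ Cᵒᵖ ⥤ Type w} (adj : L ⊣ R) :
    R ≅ yoneda ⋙ (Functor.whiskeringLeft _ _ _).obj (yoneda ⋙ L).op :=
  NatIso.ofComponents (fun Y => NatIso.ofComponents
    (fun X => (yonedaEquiv.symm.trans (adj.homEquiv (yoneda.obj X.unop) Y).symm).toIso)
    (fun {X X'} f => by
      ext x
      change (adj.homEquiv _ _).symm (yonedaEquiv.symm ((R.obj Y).map f x)) =
        L.map (yoneda.map f.unop) ≫ (adj.homEquiv _ _).symm (yonedaEquiv.symm x)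
      rw [← adj.homEquiv_naturality_left_symm]
      congr 1
      exact (yonedaEquiv_symm_naturality_left f.unop _ x).symm))
    (fun {Y Y'} g => by
      ext X x
      change (adj.homEquiv _ _).symm (yonedaEquiv.symm ((R.map g).app X x)) =
        (adj.homEquiv _ _).symm (yonedaEquiv.symm x) ≫ g
      rw [← adj.homEquiv_naturality_right_symm]
      congr 1
      exact (yonedaEquiv_symm_naturality_right _ _ _).symm)

/-- An adjunction on presheaves whose right adjoint takes values in sheaves restricts to
sheaves. -/
noncomputable def sheafAdjunction {J : GrothendieckTopology C} {A E : Type*} [Category* A]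
    [Category* E] {L : (Cᵒᵖ ⥤ A) ⥤ E} {R : E ⥤ Cᵒᵖ ⥤ A} (adj : L ⊣ R)
    (h : ∀ Y, Presheaf.IsSheaf J (R.obj Y)) :
    sheafToPresheaf J A ⋙ L ⊣ ObjectProperty.lift (Presheaf.IsSheaf J) R h :=
  adj.restrictFullyFaithful (fullyFaithfulSheafToPresheaf J A) (.id _) (Iso.refl _) (Iso.refl _)

lemma toposHasEnoughPoints_of_hasEnoughPoints (J : GrothendieckTopology C)
    [GrothendieckTopology.HasEnoughPoints.{w} J] :
    ToposHasEnoughPoints.{w} (Sheaf J (Type w)) := by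
  obtain ⟨P, _, hP⟩ := GrothendieckTopology.HasEnoughPoints.exists_objectProperty.{w} J
  let e := equivShrink.{w} (Subtype P)
  let point (Φ : GrothendieckTopology.Point.{w} J) : ToposPoint.{w} (Sheaf J (Type w)) :=
    ⟨Φ.sheafFiber, Φ.skyscraperSheafFunctor, Φ.skyscraperSheafAdjunction, inferInstance⟩
  refine ⟨Shrink (Subtype P), fun i => point (e.symm i).1, ⟨fun φ hφ => ?_⟩⟩
  have h : ∀ Φ : Subtype P, IsIso (Φ.1.sheafFiber.map φ) := e.symm.surjective.forall.2 hφ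
  exact (hP.jointlyReflectIsomorphisms_type.isIso_iff φ).2 fun Φ => h ⟨Φ.obj, Φ.property⟩

end ToposPoints

section Grids

variable {C : Type u} [Category.{w} C] {J : GrothendieckTopology C} {C₀ : Type w}
  [PartialOrder C₀] {ι₀ : C₀ ⥤ C}

lemma IsBSite.coveringMorphisms_of_comp (hJ : IsBSite J) {X Y Z : C} {g : Z ⟶ Y} {f : Y ⟶ X}
    (h : coveringMorphisms J (g ≫ f)) : coveringMorphisms J g :=
  ((hJ.comp_mem_iff g f).1 h).2

lemma IsBSite.edgeObjects_of_hom (hJ : IsBSite J) {X Y : C₀} (f : Y ⟶ X)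
    (hX : edgeObjects J ι₀ X) : edgeObjects J ι₀ Y := fun Z g =>
  hJ.coveringMorphisms_of_comp (f := ι₀.map f) (by rw [← ι₀.map_comp]; exact hX Z (g ≫ f))

lemma IsBSite.isCofiltered_edgeObjects (hJ : IsBSite J) (hC₀ : IsLambdaConnected C₀)
    (hedge : ∃ X : C₀, edgeObjects J ι₀ X) :
    IsCofiltered (edgeObjects J ι₀).FullSubcategory where
  nonempty := hedge.elim fun X hX => ⟨⟨X, hX⟩⟩
  cone_objs X Y := by
    obtain ⟨Z, ⟨f⟩, ⟨g⟩⟩ := hC₀ X.obj Y.obj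
    exact ⟨⟨Z, hJ.edgeObjects_of_hom f X.property⟩, ObjectProperty.homMk f,
      ObjectProperty.homMk g, trivial⟩
  cone_maps X Y f g := ⟨X, 𝟙 X, by ext; exact Subsingleton.elim _ _⟩

lemma IsBSite.dominatesMorphisms_edgeObjects (hJ : IsBSite J)
    (hι₀ : DominatesMorphisms ι₀ (coveringMorphisms J)) :
    DominatesMorphisms ((edgeObjects J ι₀).ι ⋙ ι₀) (coveringMorphisms J) := fun U Y f hf => by
  obtain ⟨V, q, a, h⟩ := hι₀ f hf
  exact ⟨⟨V, hJ.edgeObjects_of_hom q U.property⟩, ObjectProperty.homMk q, a, h⟩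

lemma IsGrid.dominatesMorphisms (h : IsGrid J ι₀) :
    DominatesMorphisms ι₀ (coveringMorphisms J) := fun U Y f hf => by
  obtain ⟨V, q, α, rfl⟩ := h.exists_lift U Y f hf
  exact ⟨V, q, α.inv, α.inv_hom_id_assoc _⟩

instance preservesFiniteLimits_sheafFiberFunctor
    [IsCofiltered (edgeObjects J ι₀).FullSubcategory] :
    PreservesFiniteLimits (sheafFiberFunctor J ι₀) := by
  have : PreservesFiniteLimits (fiberFunctor J ι₀) := comp_preservesFiniteLimits _ _
  exact comp_preservesFiniteLimits _ _

variable [IsCofiltered (edgeObjects J ι₀).FullSubcategory]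

/-- The adjunction between `ω` and `F_*`, on presheaves. -/
noncomputable def fiberFunctorAdjunction (hJ : IsATopology J)
    (hι₀ : DominatesMorphisms ((edgeObjects J ι₀).ι ⋙ ι₀) (coveringMorphisms J)) :
    fiberFunctor J ι₀ ⊣ directImagePresheaf J ι₀ :=
  let adj := (hι₀.point hJ).skyscraperPresheafAdjunction.ofNatIsoLeft
    (hι₀.presheafFiberIso hJ).symm
  adj.ofNatIsoRight (rightAdjointIso adj)

lemma isSheaf_directImagePresheaf_obj (hJ : IsATopology J)
    (hι₀ : DominatesMorphisms ((edgeObjects J ι₀).ι ⋙ ι₀) (coveringMorphisms J)) (Y : Type w) :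
    Presheaf.IsSheaf J ((directImagePresheaf J ι₀).obj Y) :=
  (Presheaf.isSheaf_of_iso_iff ((conjugateIsoEquiv (hι₀.point hJ).skyscraperPresheafAdjunction
    (fiberFunctorAdjunction hJ hι₀) (hι₀.presheafFiberIso hJ)).app Y)).1
      ((hι₀.point hJ).isSheaf_skyscraperPresheaf Y)

end Grids

section HomogeneousObjects

variable {D : Type*} [Category* D]

/-- An object `N` is homogeneous if its endomorphisms act transitively on the morphisms from any
given object to `N`. -/
def IsHomogeneous (N : D) : Prop :=
  ∀ ⦃T : D⦄ (f g : T ⟶ N), ∃ σ : N ⟶ N, f ≫ σ = g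

/-- A family of objects is coinitial if every object receives a morphism from one of its
members. -/
def IsCoinitialFamily {I : Type*} (A : I → D) : Prop :=
  ∀ Y : D, ∃ i, Nonempty (A i ⟶ Y)

lemma IsHomogeneous.exists_comp_eq {M N T : D} (hM : IsHomogeneous M) (f : T ⟶ N) (g : T ⟶ M)
    (k : N ⟶ M) : ∃ k' : N ⟶ M, f ≫ k' = g := by
  obtain ⟨σ, hσ⟩ := hM (f ≫ k) g
  exact ⟨k ≫ σ, by rw [← hσ, Category.assoc]⟩

/-- The right Ore condition: every cospan can be completed to a commutative square. -/
def IsOre (D : Type*) [Category* D] : Prop :=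
  ∀ ⦃X Y Y' : D⦄ (f : Y ⟶ X) (f' : Y' ⟶ X), ∃ (Z : D) (g : Z ⟶ Y) (g' : Z ⟶ Y'), g ≫ f = g' ≫ f'

lemma IsHomogeneous.exists_endomorphism_comp_eq (hD : IsOre D)
    (hepi : ∀ {X Y : D} (f : X ⟶ Y), Epi f) {M N : D} (hN : IsHomogeneous N) (p q : N ⟶ M) :
    ∃ σ : N ⟶ N, σ ≫ q = p := by
  obtain ⟨Z, a, b, h⟩ := hD p q
  obtain ⟨σ, rfl⟩ := hN a b
  have := hepi a
  exact ⟨σ, by rw [← cancel_epi a, h, Category.assoc]⟩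

lemma dominatesMorphisms_top_of_isHomogeneous (hD : IsOre D)
    (hepi : ∀ {X Y : D} (f : X ⟶ Y), Epi f) {P : Type*} [Category* P] [IsCofiltered P] {K : P ⥤ D}
    (hK : ∀ E, IsHomogeneous (K.obj E)) (hcoinitial : IsCoinitialFamily K.obj) :
    DominatesMorphisms K ⊤ := fun U Y f _ => by
  obtain ⟨V, ⟨a⟩⟩ := hcoinitial Y
  obtain ⟨W, q, r, -⟩ := IsCofilteredOrEmpty.cone_objs U V
  obtain ⟨σ, hσ⟩ := (hK W).exists_endomorphism_comp_eq hD hepi (K.map q) (K.map r ≫ a ≫ f)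
  exact ⟨W, q, σ ≫ K.map r ≫ a, by simpa only [Category.assoc] using hσ⟩

section Finite

variable {I : Type*} [Preorder I] {A : I → D}

/-- Finitely many candidates for the transition morphism `A j ⟶ A i`, so the ultrafilter selects
one of them. -/
lemma exists_eventually_comp_eq [∀ i j, Finite (A j ⟶ A i)] (hA : ∀ i, IsHomogeneous (A i))
    (t : ∀ {i j}, i ≤ j → (A j ⟶ A i)) {U : Ultrafilter I}
    (hU : ∀ i, ∀ᶠ k in (U : Filter I), i ≤ k) {i j : I} (h : i ≤ j) :
    ∃ p : A j ⟶ A i, ∀ᶠ k in (U : Filter I), ∀ (hi : i ≤ k) (hj : j ≤ k), t hj ≫ p = t hi := by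
  rw [← Ultrafilter.eventually_exists_iff]
  filter_upwards [hU j] with k hk
  obtain ⟨p, hp⟩ := (hA i).exists_comp_eq (t hk) (t (h.trans hk)) (t h)
  exact ⟨p, fun _ _ => hp⟩

lemma exists_functor_of_isDirectedOrder [IsDirectedOrder I] [Nonempty I]
    [∀ i j, Finite (A j ⟶ A i)] (hepi : ∀ {X Y : D} (f : X ⟶ Y), Epi f)
    (hA : ∀ i, IsHomogeneous (A i)) (t : ∀ {i j}, i ≤ j → (A j ⟶ A i)) :
    ∃ K : Iᵒᵖ ⥤ D, ∀ i, K.obj i = A i.unop := by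
  let U : Ultrafilter I := Ultrafilter.of Filter.atTop
  have hU (i : I) : ∀ᶠ k in (U : Filter I), i ≤ k :=
    Ultrafilter.of_le _ (Filter.eventually_ge_atTop i)
  choose p hp using @exists_eventually_comp_eq D _ I _ A _ hA t U hU
  refine ⟨{ obj := fun i => A i.unop
            map := fun f => p f.unop.le
            map_id := fun i => ?_
            map_comp := fun {l m n} f g => ?_ }, fun _ => rfl⟩
  · obtain ⟨k, hk, hik⟩ := ((hp (le_refl i.unop)).and (hU i.unop)).exists
    have := hepi (t hik)
    rw [← cancel_epi (t hik), hk hik hik, Category.comp_id]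
  · obtain ⟨k, ⟨⟨hf, hg⟩, hfg⟩, hlk⟩ := (((hp f.unop.le).and (hp g.unop.le)).and
      (hp (f ≫ g).unop.le)).and (hU l.unop) |>.exists
    have hmk := f.unop.le.trans hlk
    have hnk := g.unop.le.trans hmk
    have := hepi (t hlk)
    rw [← cancel_epi (t hlk), hfg hnk hlk, ← Category.assoc, hf hmk hlk, hg hnk hmk]

end Finite

lemma IsCoinitialFamily.exists_sequence_of_countable [Nonempty D] {I : Type*} {A : I → D}
    (hA : IsCoinitialFamily A) (hD : IsLambdaConnected D) (hcount : HasCountableCoinitialSet D) :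
    ∃ K : ℕᵒᵖ ⥤ D, (∀ n, ∃ i, K.obj n = A i) ∧ IsCoinitialFamily K.obj := by
  obtain ⟨S, hS, hcoinitial⟩ := hcount
  obtain ⟨Y₀, hY₀, -⟩ := hcoinitial (Classical.arbitrary D)
  obtain ⟨s, rfl⟩ := hS.exists_eq_range ⟨Y₀, hY₀⟩
  have hstep (n : ℕ) (i : I) : ∃ j, Nonempty (A j ⟶ A i) ∧ Nonempty (A j ⟶ s n) := by
    obtain ⟨Z, ⟨a⟩, ⟨b⟩⟩ := hD (A i) (s n)
    obtain ⟨j, ⟨c⟩⟩ := hA Z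
    exact ⟨j, ⟨c ≫ a⟩, ⟨c ≫ b⟩⟩
  choose next hnext hs using hstep
  let i (n : ℕ) : I := Nat.rec (hA Y₀).choose next n
  refine ⟨Functor.ofOpSequence (X := fun n => A (i n)) fun n => (hnext n (i n)).some,
    fun n => ⟨i n.unop, rfl⟩, fun Y => ?_⟩
  obtain ⟨_, ⟨n, rfl⟩, ⟨a⟩⟩ := hcoinitial Y
  exact ⟨op (n + 1), ⟨(hs n (i n)).some ≫ a⟩⟩

lemma IsCoinitialFamily.exists_functor_of_finite [Nonempty D] {I : Type*} {A : I → D}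
    (hA : IsCoinitialFamily A) (hD : IsLambdaConnected D) (hepi : ∀ {X Y : D} (f : X ⟶ Y), Epi f)
    (hhom : ∀ i, IsHomogeneous (A i)) (hfin : HasFiniteHoms D) :
    ∃ (_ : Preorder I) (_ : IsDirectedOrder I) (K : Iᵒᵖ ⥤ D), ∀ i, K.obj i = A i.unop := by
  let _ : Preorder I :=
    { le i j := Nonempty (A j ⟶ A i)
      le_refl i := ⟨𝟙 _⟩
      le_trans i j k := fun ⟨f⟩ ⟨g⟩ => ⟨g ≫ f⟩ }
  have : Nonempty I := ⟨(hA (Classical.arbitrary D)).choose⟩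
  have hdir : IsDirectedOrder I := ⟨fun i j => by
    obtain ⟨Z, ⟨a⟩, ⟨b⟩⟩ := hD (A i) (A j)
    obtain ⟨k, ⟨c⟩⟩ := hA Z
    exact ⟨k, ⟨c ≫ a⟩, ⟨c ≫ b⟩⟩⟩
  have (i j : I) : Finite (A j ⟶ A i) := hfin _ _
  exact ⟨_, hdir, exists_functor_of_isDirectedOrder hepi hhom fun h => h.some⟩

lemma IsCoinitialFamily.exists_cofiltered_diagram [Nonempty D] {I : Type w} {A : I → D}
    (hA : IsCoinitialFamily A) (hD : IsLambdaConnected D)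
    (hepi : ∀ {X Y : D} (f : X ⟶ Y), Epi f) (hhom : ∀ i, IsHomogeneous (A i))
    (hcard : HasFiniteHoms D ∨ HasCountableCoinitialSet D) :
    ∃ (P : Type w) (_ : SmallCategory P) (_ : IsCofiltered P) (K : P ⥤ D),
      (∀ E, IsHomogeneous (K.obj E)) ∧ IsCoinitialFamily K.obj := by
  rcases hcard with hfin | hcount
  · have : Nonempty I := ⟨(hA (Classical.arbitrary D)).choose⟩
    obtain ⟨_, _, K, hK⟩ := hA.exists_functor_of_finite hD hepi hhom hfin
    refine ⟨Iᵒᵖ, inferInstance, inferInstance, K, fun E => hK E ▸ hhom _, fun Y => ?_⟩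
    obtain ⟨i, ⟨a⟩⟩ := hA Y
    exact ⟨op i, ⟨eqToHom (hK _) ≫ a⟩⟩
  · obtain ⟨K, hKA, hK⟩ := hA.exists_sequence_of_countable hD hcount
    let d : ULift.{w} ℕ ⥤ ℕ := Monotone.functor (f := ULift.down) fun _ _ h => h
    refine ⟨(ULift.{w} ℕ)ᵒᵖ, inferInstance, inferInstance, d.op ⋙ K, fun E => ?_, fun Y => ?_⟩
    · obtain ⟨i, hi⟩ := hKA (op E.unop.down)
      exact hi ▸ hhom i
    · obtain ⟨n, a⟩ := hK Y
      exact ⟨op ⟨n.unop⟩, a⟩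

lemma exists_small_coinitialFamily [EssentiallySmall.{w} D] (P : ObjectProperty D)
    (hP : IsCoinitialFamily (Subtype.val : Subtype P → D)) :
    ∃ (I : Type w) (A : I → D), (∀ i, P (A i)) ∧ IsCoinitialFamily A := by
  have : ObjectProperty.EssentiallySmall.{w} P := .of_le (Q := ⊤) le_top
  obtain ⟨Q, _, hQP, hPQ⟩ := ObjectProperty.EssentiallySmall.exists_small_le.{w} P
  let e := (equivShrink.{w} (Subtype Q)).symm
  refine ⟨Shrink (Subtype Q), fun i => (e i).1, fun i => hQP _ (e i).2, fun Y => ?_⟩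
  obtain ⟨N, ⟨a⟩⟩ := hP Y
  obtain ⟨M, hM, ⟨i⟩⟩ := hPQ _ N.2
  obtain ⟨j, hj⟩ := e.surjective ⟨M, hM⟩
  exact ⟨j, ⟨eqToHom (congrArg Subtype.val hj) ≫ i.inv ≫ a⟩⟩

end HomogeneousObjects

section CoveringCategory

variable {C : Type u} [Category.{w} C] {J : GrothendieckTopology C}

lemma IsOre.over {D : Type*} [Category* D] (hD : IsOre D) (X : D) : IsOre (Over X) :=
  fun _ Y _ f f' => by
    obtain ⟨Z, g, g', h⟩ := hD f.left f'.left
    exact ⟨Over.mk (g ≫ Y.hom), Over.homMk g, Over.homMk g' (by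
      change g' ≫ _ = g ≫ Y.hom
      rw [← Over.w f', ← reassoc_of% h, Over.w f]), Over.OverMorphism.ext h⟩

lemma IsOre.isLambdaConnected_over {D : Type*} [Category* D] (hD : IsOre D) (X : D) :
    IsLambdaConnected (Over X) := fun Y Y' => by
  obtain ⟨Z, g, g', -⟩ := hD.over X (Over.mkIdTerminal.from Y) (Over.mkIdTerminal.from Y')
  exact ⟨Z, ⟨g⟩, ⟨g'⟩⟩

lemma IsBSite.isOre_coveringCategory (hJ : IsBSite J) : IsOre (CoveringCategory J) :=
  fun _ _ _ f f' => by
    obtain ⟨Z, g', ⟨_, g, _, ⟨⟩, h⟩, hg'⟩ := hJ.isATopology.exists_coveringMorphisms_of_mem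
      (J.pullback_stable f'.hom f.property)
    have hg : coveringMorphisms J g := hJ.coveringMorphisms_of_comp (f := f.hom) (by
      rw [h]; exact (coveringMorphisms J).comp_mem _ _ hg' f'.property)
    exact ⟨⟨Z⟩, ⟨g, hg⟩, ⟨g', hg'⟩, WideSubcategory.hom_ext _ h⟩

lemma IsBSite.epi_over_coveringCategory (hJ : IsBSite J) {X : CoveringCategory J} {Y Y' : Over X}
    (f : Y ⟶ Y') : Epi f :=
  have : Epi ((Over.forget X ⋙ wideSubcategoryInclusion _).map f) := hJ.epi _
  (Over.forget X ⋙ wideSubcategoryInclusion _).epi_of_epi_map this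

lemma IsGaloisCovering.isHomogeneous (hJ : IsBSite J) {X Y : CoveringCategory J} {f : Y ⟶ X}
    (hf : IsGaloisCovering f.hom) : IsHomogeneous (Over.mk f) := fun T a b => by
  obtain ⟨G, _, ρ, h⟩ := hf
  have hab : a.left.hom ≫ f.hom = b.left.hom ≫ f.hom :=
    congrArg (fun c => c.hom) ((Over.w a).trans (Over.w b).symm)
  obtain ⟨g, hg⟩ := @IsPseudoTorsor.injective G _ _ _ (homMulAction ρ _) _ (h _) _ _ hab
  have hσ : (ρ g).hom.left ≫ f.hom = f.hom := Over.w (ρ g).hom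
  let σ : Y ⟶ Y := ⟨(ρ g).hom.left, hJ.coveringMorphisms_of_comp (f := f.hom) (by
    rw [hσ]; exact f.property)⟩
  exact ⟨Over.homMk σ (WideSubcategory.hom_ext _ hσ),
    Over.OverMorphism.ext (WideSubcategory.hom_ext _ hg)⟩

lemma HasEnoughGaloisCoverings.isCoinitialFamily_isHomogeneous
    (hgal : HasEnoughGaloisCoverings (coveringMorphisms J)) (hJ : IsBSite J)
    (X : CoveringCategory J) :
    IsCoinitialFamily (Subtype.val : {N : Over X // IsHomogeneous N} → Over X) := fun Y => by
  have hY : dominated (coveringMorphisms J) Y.hom.hom :=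
    ⟨_, 𝟙 _, by rw [Category.id_comp]; exact Y.hom.property⟩
  rw [← hgal] at hY
  obtain ⟨Z, g, hg, hgal⟩ := hY
  let N : (⟨Z⟩ : CoveringCategory J) ⟶ X := ⟨g ≫ Y.hom.hom, hg⟩
  exact ⟨⟨Over.mk N, IsGaloisCovering.isHomogeneous hJ hgal⟩,
    ⟨Over.homMk ⟨g, hJ.coveringMorphisms_of_comp hg⟩ rfl⟩⟩

lemma IsBSite.coveringMorphisms_of_isIso (hJ : IsBSite J) {X Y : C} (f : Y ⟶ X) [IsIso f] :
    coveringMorphisms J f :=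
  hJ.coveringMorphisms_of_comp (f := inv f) (by
    rw [IsIso.hom_inv_id]; exact (coveringMorphisms J).id_mem _)

lemma IsBSite.essentiallySmall_coveringCategory [EssentiallySmall.{w} C] (hJ : IsBSite J) :
    EssentiallySmall.{w} (CoveringCategory J) := by
  let e := equivSmallModel.{w} C
  refine (essentiallySmall_iff_objectPropertyEssentiallySmall_top.{w} _).2
    ⟨.ofObj fun S => (⟨e.inverse.obj S⟩ : CoveringCategory J), inferInstance, fun X _ => ?_⟩
  exact ⟨_, ⟨e.functor.obj X.obj⟩, ⟨WideSubcategory.isoMk (e.unitIso.app X.obj)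
    (hJ.coveringMorphisms_of_isIso _) (hJ.coveringMorphisms_of_isIso _)⟩⟩

lemma IsBSite.exists_dominatesMorphisms_over [EssentiallySmall.{w} C] (hJ : IsBSite J)
    (hgal : HasEnoughGaloisCoverings (coveringMorphisms J)) (X : CoveringCategory J)
    (hcard : HasFiniteHoms (Over X) ∨ HasCountableCoinitialSet (Over X)) :
    ∃ (P : Type w) (_ : SmallCategory P) (_ : IsCofiltered P) (K : P ⥤ Over X),
      DominatesMorphisms K ⊤ := by
  have := hJ.essentiallySmall_coveringCategory
  have : EssentiallySmall.{w} (Over X) :=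
    inferInstanceAs (EssentiallySmall.{w} (CostructuredArrow _ _))
  obtain ⟨I, A, hA, hcoinitial⟩ := exists_small_coinitialFamily.{w} (IsHomogeneous (D := Over X))
    (hgal.isCoinitialFamily_isHomogeneous hJ X)
  have hore := hJ.isOre_coveringCategory
  have : Nonempty (Over X) := ⟨Over.mk (𝟙 X)⟩
  obtain ⟨P, _, _, K, hK, hKc⟩ := hcoinitial.exists_cofiltered_diagram
    (hore.isLambdaConnected_over X) hJ.epi_over_coveringCategory hA hcard
  exact ⟨P, _, ‹_›, K,
    dominatesMorphisms_top_of_isHomogeneous (hore.over X) hJ.epi_over_coveringCategory hK hKc⟩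

lemma DominatesMorphisms.comp_forget {P : Type*} [Category* P] {X : CoveringCategory J}
    {K : P ⥤ Over X} (hK : DominatesMorphisms K ⊤) :
    DominatesMorphisms (K ⋙ Over.forget X ⋙ wideSubcategoryInclusion _) (coveringMorphisms J) :=
  fun U Y f hf => by
    let f' : (⟨Y⟩ : CoveringCategory J) ⟶ (K.obj U).left := ⟨f, hf⟩
    obtain ⟨V, q, a, h⟩ := hK (Over.homMk f' : Over.mk (f' ≫ (K.obj U).hom) ⟶ K.obj U) trivial
    exact ⟨V, q, a.left.hom, congrArg (fun b => b.left.hom) h⟩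

end CoveringCategory

section EnoughPoints

variable {C : Type u} [Category.{w} C] {J : GrothendieckTopology C}

open GrothendieckTopology.Point.ofIsCofiltered in
lemma DominatesMorphisms.mem_of_fiber_map_eq_fiberMk {N : Type w} [SmallCategory N] [IsCofiltered N]
    {p : N ⥤ C} (hp : DominatesMorphisms p (coveringMorphisms J)) (hJ : IsATopology J) {U : N}
    {X : C} {f : p.obj U ⟶ X} (hf : ∀ ⦃V⦄ (q : V ⟶ U), coveringMorphisms J (p.map q ≫ f))
    {S : Sieve X} {Y : C} {g : Y ⟶ X} (hg : S g) {y : (hp.point hJ).fiber.obj Y}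
    (h : (hp.point hJ).fiber.map g y = fiberMk.{w} f) : S ∈ J X := by
  obtain ⟨U', b, rfl⟩ := fiberMk_jointly_surjective y
  obtain ⟨V, q, q', -⟩ := IsCofilteredOrEmpty.cone_objs U U'
  have hV : fiberMk.{w} (p.map q' ≫ b ≫ g) = fiberMk.{w} (p.map q ≫ f) := by
    rw [fiberMk_map_comp, fiberMk_map_comp, ← h]
    exact (fiber_map_fiberMk.{w} p b g).symm
  obtain ⟨W, r, hr⟩ := exists_of_fiberMk_eq_fiberMk hV
  have hrf := hf (r ≫ q)
  rw [p.map_comp, Category.assoc, ← hr] at hrf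
  refine J.superset_covering ((Sieve.generate_le_iff _ _).2 ?_) hrf
  rintro _ _ ⟨⟩
  simpa only [Category.assoc] using S.downward_closed hg (p.map r ≫ p.map q' ≫ b)

lemma hasEnoughPoints_of_forall_exists_point [EssentiallySmall.{w} C]
    (h : ∀ X : C, ∃ Φ : GrothendieckTopology.Point.{w} J, ∀ S : Sieve X,
      (∀ x : Φ.fiber.obj X, ∃ (Y : C) (g : Y ⟶ X) (_ : S g) (y : Φ.fiber.obj Y),
        Φ.fiber.map g y = x) → S ∈ J X) :
    GrothendieckTopology.HasEnoughPoints.{w} J := by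
  have : HasSheafify J (Type w) := hasSheafifyEssentiallySmallSite ..
  choose Φ hΦ using h
  let e := equivSmallModel.{w} C
  refine ⟨.ofObj fun S => Φ (e.inverse.obj S), inferInstance, .mk' fun X S hS => ?_⟩
  let i : e.inverse.obj (e.functor.obj X) ≅ X := e.unitIso.symm.app X
  rw [← GrothendieckTopology.pullback_mem_iff_of_isIso (i := i.hom)]
  refine hΦ _ _ fun x => ?_
  obtain ⟨Y, g, hg, y, hy⟩ := hS ⟨_, ⟨e.functor.obj X⟩⟩ ((Φ _).fiber.map i.hom x)
  refine ⟨Y, g ≫ i.inv, by simpa [Sieve.pullback_apply] using hg, y, ?_⟩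
  rw [Functor.map_comp, ConcreteCategory.comp_apply, hy, ← ConcreteCategory.comp_apply,
    ← Functor.map_comp, i.hom_inv_id, CategoryTheory.Functor.map_id, ConcreteCategory.id_apply]

lemma IsBSite.hasEnoughPoints [EssentiallySmall.{w} C] (hJ : IsBSite J)
    (hgal : HasEnoughGaloisCoverings (coveringMorphisms J))
    (hcard : ∀ X : CoveringCategory J,
      HasFiniteHoms (Over X) ∨ HasCountableCoinitialSet (Over X)) :
    GrothendieckTopology.HasEnoughPoints.{w} J :=
  hasEnoughPoints_of_forall_exists_point fun X => by
    obtain ⟨P, _, _, K, hK⟩ := hJ.exists_dominatesMorphisms_over hgal ⟨X⟩ (hcard ⟨X⟩)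
    refine ⟨hK.comp_forget.point hJ.isATopology, fun S hS => ?_⟩
    obtain ⟨E⟩ : Nonempty P := IsCofiltered.nonempty
    obtain ⟨Y, g, hg, y, hy⟩ := hS (GrothendieckTopology.Point.ofIsCofiltered.fiberMk.{w}
      (p := K ⋙ Over.forget _ ⋙ wideSubcategoryInclusion _) (U := E) (K.obj E).hom.hom)
    exact hK.comp_forget.mem_of_fiber_map_eq_fiberMk hJ.isATopology
      (fun V q => by
        have hV : (K.map q).left.hom ≫ (K.obj E).hom.hom = (K.obj V).hom.hom :=
          congrArg (fun c => c.hom) (Over.w (K.map q))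
        exact hV.symm ▸ (K.obj V).hom.property) hg hy

end EnoughPoints

theorem theorem8p6_general {C : Type u} [Category.{w} C] (J : GrothendieckTopology C)
    (hJ : IsBSite J) :
    (∀ (C₀ : Type w) [PartialOrder C₀] (ι₀ : C₀ ⥤ C), IsLambdaConnected C₀ →
      DominatesMorphisms ι₀ (coveringMorphisms J) → (∃ X, edgeObjects J ι₀ X) →
      PreservesFiniteLimits (sheafFiberFunctor J ι₀) ∧
      ∃ h : ∀ Y : Type w, Presheaf.IsSheaf J ((directImagePresheaf J ι₀).obj Y),
        Nonempty (sheafFiberFunctor J ι₀ ⊣ directImageSheaf J ι₀ h) ∧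
        ∃ p : ToposPoint.{w} (Sheaf J (Type w)),
          p.inverseImage = sheafFiberFunctor J ι₀ ∧
          p.directImage = directImageSheaf J ι₀ h) ∧
    (EssentiallySmall.{w} C → HasEnoughGaloisCoverings (coveringMorphisms J) →
      (∀ X : CoveringCategory J, HasFiniteHoms (Over X) ∨ HasCountableCoinitialSet (Over X)) →
      ToposHasEnoughPoints.{w} (Sheaf J (Type w))) := by
  refine ⟨fun C₀ _ ι₀ hC₀ hι₀ hedge => ?_, fun _ hgal hcard => ?_⟩
  · have := hJ.isCofiltered_edgeObjects hC₀ hedge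
    have hedges := hJ.dominatesMorphisms_edgeObjects hι₀
    have hsheaf := isSheaf_directImagePresheaf_obj hJ.isATopology hedges
    let adj : sheafFiberFunctor J ι₀ ⊣ directImageSheaf J ι₀ hsheaf :=
      sheafAdjunction (fiberFunctorAdjunction hJ.isATopology hedges) hsheaf
    exact ⟨inferInstance, hsheaf, ⟨adj⟩, ⟨_, _, adj, inferInstance⟩, rfl, rfl⟩
  · have := hJ.hasEnoughPoints hgal hcard
    exact toposHasEnoughPoints_of_hasEnoughPoints J

theorem theorem8p6 {C : Type u} [Category.{w} C] (J : GrothendieckTopology C) (hJ : IsYSite J)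
    (hcard : ∀ X : CoveringCategory J,
      HasFiniteHoms (Over X) ∨ HasCountableCoinitialSet (Over X)) :
    (∀ [Nonempty C] (C₀ : Type w) [PartialOrder C₀] (ι₀ : C₀ ⥤ C), IsGrid J ι₀ →
      PreservesFiniteLimits (sheafFiberFunctor J ι₀) ∧
      ∃ h : ∀ Y : Type w, Presheaf.IsSheaf J ((directImagePresheaf J ι₀).obj Y),
        Nonempty (sheafFiberFunctor J ι₀ ⊣ directImageSheaf J ι₀ h) ∧
        ∃ p : ToposPoint.{w} (Sheaf J (Type w)),
          p.inverseImage = sheafFiberFunctor J ι₀ ∧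
          p.directImage = directImageSheaf J ι₀ h) ∧
    ToposHasEnoughPoints.{w} (Sheaf J (Type w)) := by
  obtain ⟨hgrid, hpoints⟩ := theorem8p6_general J hJ.toIsBSite
  exact ⟨fun C₀ _ ι₀ h => hgrid C₀ ι₀ h.isLambdaConnected h.dominatesMorphisms
    ((h.exists_edge (Classical.arbitrary C)).imp fun _ => And.left),
    hpoints hJ.essentiallySmall hJ.enoughGalois hcard⟩
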